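/- For real normed spaces $X,Y$ of the same finite dimension let $d_{BM}(X,Y)=\inf\{\|T\|\,\|T^{-1}\| : T\colon X\to Y \text{ an invertible linear operator}\}$ be the (multiplicative) Banach--Mazur distance, and let $\ell_2^n$ denote $\mathbb{R}^n$ with the Euclidean norm. For $p\in[1,\infty]$ let $X_1\oplus_p\cdots\oplus_p X_k$ be the direct sum with the norm $\|(x^1,\dots,x^k)\|=\bigl(\sum_{i=1}^k\|x^i\|_{X_i}^p\bigr)^{1/p}$ (for $p=\infty$: $\max_i\|x^i\|_{X_i}$). Let $k\ge 1$ and $n_1,\dots,n_k\ge 1$ be integers, let $X_i$ be an $n_i$-dimensional real normed space, and put $d_i=d_{BM}(X_i,\ell_2^{n_i})$ for $i=1,\dots,k$. For $p\in[1,\infty]$ define $$f(p)=d_{BM}\bigl(X_1\oplus_p\cdots\oplus_p X_k,\ \ell_2^{n_1+\cdots+n_k}\bigr).$$ Then, for every $p\in[1,\infty]$, $$\max\{d_1,\dots,d_k\}=f(2)\le f(p)=f\Bigl(\frac{p}{p-1}\Bigr)\le f(1)=f(\infty)=\sqrt{d_1^2+\cdots+d_k^2},$$ where $\frac{p}{p-1}$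 is read as $\infty$ for $p=1$ and as $1$ for $p=\infty$. -/

import Mathlib

open scoped ENNReal

/-- The (multiplicative) Banach--Mazur distance between two real normed spaces: the infimum of
`‖T‖ * ‖T⁻¹‖` over all invertible bounded linear operators `T : X → Y`. In finite dimension every
linear operator is bounded; for spaces of the same finite dimension the index type is nonempty. -/
noncomputable def banachMazurDist (X Y : Type*) [NormedAddCommGroup X] [NormedSpace ℝ X]
    [NormedAddCommGroup Y] [NormedSpace ℝ Y] : ℝ :=
  ⨅ T : X ≃L[ℝ] Y, ‖(T : X →L[ℝ] Y)‖ * ‖(T.symm : Y →L[ℝ] X)‖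

/-- The Banach--Mazur distance from the `ℓ_p`-direct sum of `X 0, …, X (k - 1)`, where `X i` has
dimension `n i`, to the Euclidean space of dimension `∑ i, n i`. -/
noncomputable def lpSumDist {k : ℕ} (n : Fin k → ℕ) (X : Fin k → Type*)
    [∀ i, NormedAddCommGroup (X i)] [∀ i, NormedSpace ℝ (X i)]
    (p : ℝ≥0∞) [Fact (1 ≤ p)] : ℝ :=
  banachMazurDist (PiLp p X) (EuclideanSpace ℝ (Fin (∑ i, n i)))

/-! For `p ≤ 2`, `f(p)` is the norm of the diagonal operator `diag(d)` from `ℓ_2^k` to `ℓ_p^k`; for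
`p ≥ 2` it is the norm of `diag(d)` from `ℓ_p^k` to `ℓ_2^k`. The theorem then reduces to facts about
diagonal operators: the two norms agree for conjugate exponents because `diag(d)` is its own
transpose, the norm is `max d_i` at `p = 2`, and Cauchy–Schwarz evaluates it as `√(∑ d_i²)` at `p =
1, ∞`.

Upper bound: combine nearly optimal maps of the blocks, scaled so that one of the two operator norms
costs only the inequality between the `ℓ_p` and `ℓ_2` norms (`lpSumDist_le_of_le_two`,
`lpSumDist_le_of_two_le`).

Lower bound: an arbitrary isomorphism `S` need not send the blocks to orthogonal subspaces. But each
block has unit vectors `u_i`, `v_i` with `d_i ‖S v_i‖ ≤ ‖S u_i‖`, and suitable signs make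
combinations of the images satisfy the needed half of the Pythagorean identity, while signs do not
change the norm in the `ℓ_p`-sum. Hence `‖S‖ ‖S⁻¹‖` dominates both diagonal norms, for every `p`
(`diagBound_two_left_lpSumDist`, `diagBound_two_right_lpSumDist`). -/

/-! ### Finite `ℓ_p` norms and duality for diagonal operators -/

section LpNorm

variable {ι : Type*} [Fintype ι]

/-- The `ℓ_p`-norm of a finite family of real numbers. -/
noncomputable def lpNorm (p : ℝ≥0∞) [Fact (1 ≤ p)] (t : ι → ℝ) : ℝ :=
  ‖(WithLp.toLp p t : PiLp p fun _ : ι => ℝ)‖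

theorem one_le_toReal_of_fact {p : ℝ≥0∞} [hp : Fact (1 ≤ p)] (h : p ≠ ∞) : 1 ≤ p.toReal := by
  rw [← ENNReal.toReal_one]
  exact ENNReal.toReal_mono h hp.out

theorem lpNorm_nonneg (p : ℝ≥0∞) [Fact (1 ≤ p)] (t : ι → ℝ) : 0 ≤ lpNorm p t := norm_nonneg _

theorem lpNorm_zero (p : ℝ≥0∞) [Fact (1 ≤ p)] : lpNorm p (0 : ι → ℝ) = 0 := by
  simp [lpNorm]

theorem lpNorm_smul (p : ℝ≥0∞) [Fact (1 ≤ p)] (c : ℝ) (t : ι → ℝ) :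
    lpNorm p (c • t) = |c| * lpNorm p t := by
  simp [lpNorm, norm_smul]

theorem lpNorm_pos (p : ℝ≥0∞) [Fact (1 ≤ p)] {t : ι → ℝ} (ht : t ≠ 0) : 0 < lpNorm p t := by
  simpa [lpNorm] using ht

theorem lpNorm_eq_sum {p : ℝ≥0∞} [Fact (1 ≤ p)] (h : p ≠ ∞) (t : ι → ℝ) :
    lpNorm p t = (∑ i, |t i| ^ p.toReal) ^ (1 / p.toReal) := by
  rw [lpNorm, PiLp.norm_eq_sum (zero_lt_one.trans_le (one_le_toReal_of_fact h))]
  simp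

theorem lpNorm_single [DecidableEq ι] (p : ℝ≥0∞) [Fact (1 ≤ p)] (i : ι) (c : ℝ) :
    lpNorm p (Pi.single i c) = |c| := by
  simp [lpNorm]

theorem lpNorm_two_sq (t : ι → ℝ) : lpNorm 2 t ^ 2 = ∑ i, t i ^ 2 := by
  rw [lpNorm, PiLp.norm_sq_eq_of_L2]
  simp

theorem lpNorm_one (t : ι → ℝ) : lpNorm 1 t = ∑ i, |t i| := by
  rw [lpNorm, PiLp.norm_eq_of_L1]
  simp

theorem norm_piLp_eq_lpNorm {β : ι → Type*} [∀ i, SeminormedAddCommGroup (β i)]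
    (p : ℝ≥0∞) [Fact (1 ≤ p)] (x : PiLp p β) : ‖x‖ = lpNorm p fun i => ‖x i‖ := by
  by_cases h : p = ∞
  · subst h
    simp [lpNorm, PiLp.norm_eq_ciSup]
  · have hp := zero_lt_one.trans_le (one_le_toReal_of_fact h)
    simp [lpNorm, PiLp.norm_eq_sum hp]

theorem abs_apply_le_lpNorm (p : ℝ≥0∞) [Fact (1 ≤ p)] (t : ι → ℝ) (i : ι) :
    |t i| ≤ lpNorm p t :=
  PiLp.norm_apply_le (WithLp.toLp p t : PiLp p fun _ : ι => ℝ) i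

theorem lpNorm_top_le {t : ι → ℝ} {c : ℝ} (hc : 0 ≤ c) (h : ∀ i, |t i| ≤ c) :
    lpNorm ∞ t ≤ c := by
  rw [lpNorm, PiLp.norm_eq_ciSup]
  exact Real.iSup_le h hc

theorem lpNorm_mono (p : ℝ≥0∞) [Fact (1 ≤ p)] {s t : ι → ℝ} (h : ∀ i, |s i| ≤ |t i|) :
    lpNorm p s ≤ lpNorm p t := by
  by_cases hp : p = ∞
  · subst hp
    exact lpNorm_top_le (lpNorm_nonneg _ _) fun i => (h i).trans (abs_apply_le_lpNorm _ _ i)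
  · have := one_le_toReal_of_fact hp
    rw [lpNorm_eq_sum hp, lpNorm_eq_sum hp]
    refine Real.rpow_le_rpow (by positivity) (Finset.sum_le_sum fun i _ => ?_) (by positivity)
    exact Real.rpow_le_rpow (abs_nonneg _) (h i) (by positivity)

theorem lpNorm_anti {p q : ℝ≥0∞} [Fact (1 ≤ p)] [Fact (1 ≤ q)] (hpq : p ≤ q) (t : ι → ℝ) :
    lpNorm q t ≤ lpNorm p t := by
  by_cases hq : q = ∞
  · subst hq
    exact lpNorm_top_le (lpNorm_nonneg _ _) fun i => abs_apply_le_lpNorm _ _ i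
  have hp : p ≠ ∞ := ne_top_of_le_ne_top hq hpq
  by_cases ht : t = 0
  · simp [ht, lpNorm_zero]
  have hp1 := one_le_toReal_of_fact hp
  have hq1 := one_le_toReal_of_fact hq
  have hpqr : p.toReal ≤ q.toReal := ENNReal.toReal_mono hq hpq
  set N := lpNorm p t with hN
  have hNpos : 0 < N := lpNorm_pos p ht
  have hsum : ∑ i, |t i| ^ p.toReal = N ^ p.toReal := by
    rw [hN, lpNorm_eq_sum hp, ← Real.rpow_mul (by positivity), one_div_mul_cancel (by positivity),
      Real.rpow_one]
  have hle : ∑ i, |t i| ^ q.toReal ≤ N ^ q.toReal := by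
    -- Each coordinate is at most `N`, so the surplus power `q - p` can be replaced by a power of
    -- `N`.
    calc ∑ i, |t i| ^ q.toReal = ∑ i, |t i| ^ (q.toReal - p.toReal) * |t i| ^ p.toReal :=
          Finset.sum_congr rfl fun i _ => by
            rw [← Real.rpow_add_of_nonneg (abs_nonneg _) (sub_nonneg.2 hpqr) (by positivity),
              sub_add_cancel]
      _ ≤ ∑ i, N ^ (q.toReal - p.toReal) * |t i| ^ p.toReal :=
          Finset.sum_le_sum fun i _ => mul_le_mul_of_nonneg_right
            (Real.rpow_le_rpow (abs_nonneg _) (abs_apply_le_lpNorm p t i) (sub_nonneg.2 hpqr))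
            (by positivity)
      _ = N ^ q.toReal := by
          rw [← Finset.mul_sum, hsum, ← Real.rpow_add hNpos, sub_add_cancel]
  rw [lpNorm_eq_sum hq, one_div, Real.rpow_inv_le_iff_of_pos (by positivity) hNpos.le
    (by positivity)]
  exact hle

theorem sum_mul_le_lpNorm_mul_lpNorm {p q : ℝ≥0∞} [Fact (1 ≤ p)] [Fact (1 ≤ q)]
    (hp : p ≠ ∞) (hq : q ≠ ∞) (hpq : p.toReal.HolderConjugate q.toReal) (s t : ι → ℝ) :
    ∑ i, s i * t i ≤ lpNorm p s * lpNorm q t := by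
  rw [lpNorm_eq_sum hp, lpNorm_eq_sum hq]
  exact Real.inner_le_Lp_mul_Lq _ _ _ hpq

theorem exists_sum_mul_eq_lpNorm {p q : ℝ≥0∞} [Fact (1 ≤ p)] [Fact (1 ≤ q)]
    (hp : p ≠ ∞) (hq : q ≠ ∞) (hpq : p.toReal.HolderConjugate q.toReal) (s : ι → ℝ) :
    ∃ t : ι → ℝ, lpNorm q t ≤ 1 ∧ ∑ i, s i * t i = lpNorm p s := by
  obtain ⟨g, hg, hsum⟩ := (NNReal.isGreatest_Lp Finset.univ (fun i => Real.nnabs (s i)) hpq).1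
  -- The extremal `g` for Hölder's inequality is nonnegative; the signs of `s` are put back.
  refine ⟨fun i => SignType.sign (s i) * g i, ?_, ?_⟩
  · have h1 : ∑ i, (g i : ℝ) ^ q.toReal ≤ 1 := by exact_mod_cast hg
    have hq1 := one_le_toReal_of_fact hq
    refine (lpNorm_mono q (t := fun i => (g i : ℝ)) fun i => ?_).trans ?_
    · rcases lt_trichotomy (s i) 0 with h | h | h <;> simp [h]
    · rw [lpNorm_eq_sum hq]
      refine Real.rpow_le_one (by positivity) ?_ (by positivity)
      simpa using h1
  · have h2 := congrArg NNReal.toReal hsum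
    push_cast at h2
    rw [lpNorm_eq_sum hp, ← h2]
    refine Finset.sum_congr rfl fun i _ => ?_
    rw [← mul_assoc, self_mul_sign]

/-- The diagonal operator with entries `d`, from `ℓ_p` to `ℓ_r`, has norm at most `D`. -/
def DiagBound (d : ι → ℝ) (p r : ℝ≥0∞) [Fact (1 ≤ p)] [Fact (1 ≤ r)] (D : ℝ) : Prop :=
  ∀ t : ι → ℝ, lpNorm r (fun i => d i * t i) ≤ D * lpNorm p t

theorem sum_mul_le_lpNorm_two (s t : ι → ℝ) : ∑ i, s i * t i ≤ lpNorm 2 s * lpNorm 2 t :=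
  sum_mul_le_lpNorm_mul_lpNorm (by simp) (by simp) (by simpa using Real.HolderConjugate.two_two)
    s t

/-- Duality without dual spaces: with `s = d t`, one has `‖s‖₂² = ∑ (d_i s_i) t_i`, and Hölder
followed by the hypothesis at `s` leaves one factor `‖s‖₂` to cancel. -/
theorem diagBound_two_right_of_two_left {p q : ℝ≥0∞} [Fact (1 ≤ p)] [Fact (1 ≤ q)]
    (hp : p ≠ ∞) (hq : q ≠ ∞) (hpq : p.toReal.HolderConjugate q.toReal) {d : ι → ℝ} {D : ℝ}
    (h : DiagBound d 2 p D) : DiagBound d q 2 D := by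
  intro t
  set s : ι → ℝ := fun i => d i * t i with hs
  by_cases h0 : s = 0
  -- `D` is not assumed nonnegative; the hypothesis at a nonzero vector forces it.
  · have hD : 0 ≤ D * lpNorm q t := by
      by_cases ht : t = 0
      · simp [ht, lpNorm_zero]
      · have := (lpNorm_nonneg p _).trans (h t)
        exact mul_nonneg (nonneg_of_mul_nonneg_left this (lpNorm_pos 2 ht)) (lpNorm_nonneg _ _)
    simpa [h0, lpNorm_zero] using hD
  have h1 : lpNorm 2 s ^ 2 ≤ lpNorm 2 s * (D * lpNorm q t) := by
    calc lpNorm 2 s ^ 2 = ∑ i, (d i * s i) * t i := by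
          rw [lpNorm_two_sq]; exact Finset.sum_congr rfl fun i _ => by simp only [hs]; ring
      _ ≤ lpNorm p (fun i => d i * s i) * lpNorm q t := sum_mul_le_lpNorm_mul_lpNorm hp hq hpq _ _
      _ ≤ (D * lpNorm 2 s) * lpNorm q t := by
          gcongr
          · exact lpNorm_nonneg _ _
          · exact h s
      _ = _ := by ring
  rw [sq] at h1
  exact le_of_mul_le_mul_left h1 (lpNorm_pos 2 h0)

/-- The `ℓ_p` norm of `d t` is attained against some `y` in the `ℓ_q` unit ball; moving `d` onto `y`
and applying Cauchy–Schwarz gives the bound. -/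
theorem diagBound_two_left_of_two_right {p q : ℝ≥0∞} [Fact (1 ≤ p)] [Fact (1 ≤ q)]
    (hp : p ≠ ∞) (hq : q ≠ ∞) (hpq : p.toReal.HolderConjugate q.toReal) {d : ι → ℝ} {D : ℝ}
    (hD : 0 ≤ D) (h : DiagBound d q 2 D) : DiagBound d 2 p D := by
  intro t
  obtain ⟨y, hy, hsum⟩ := exists_sum_mul_eq_lpNorm hp hq hpq fun i => d i * t i
  calc lpNorm p (fun i => d i * t i) = ∑ i, (d i * y i) * t i := by
        rw [← hsum]; exact Finset.sum_congr rfl fun i _ => by ring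
    _ ≤ lpNorm 2 (fun i => d i * y i) * lpNorm 2 t := sum_mul_le_lpNorm_two _ _
    _ ≤ (D * 1) * lpNorm 2 t := by
        gcongr
        · exact lpNorm_nonneg _ _
        · exact (h y).trans (by gcongr)
    _ = _ := by ring

end LpNorm

/-! ### Choosing signs in an inner product space -/

section Signs

variable {ι E : Type*} [NormedAddCommGroup E] [InnerProductSpace ℝ E]

/-- Greedy choice: each new sign makes the inner product with the partial sum nonpositive, so the
cross term only helps. -/
theorem exists_signs_norm_sum_sq_le (y : ι → E) (s : Finset ι) :
    ∃ ε : ι → ℝ, (∀ i, |ε i| = 1) ∧ ‖∑ i ∈ s, ε i • y i‖ ^ 2 ≤ ∑ i ∈ s, ‖y i‖ ^ 2 := by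
  classical
  induction s using Finset.induction_on with
  | empty => exact ⟨fun _ => 1, by simp, by simp⟩
  | insert j s hj ih =>
    obtain ⟨ε, hε, h⟩ := ih
    have key : ∃ c : ℝ, |c| = 1 ∧
        ‖c • y j + ∑ i ∈ s, ε i • y i‖ ^ 2 ≤ ‖y j‖ ^ 2 + ‖∑ i ∈ s, ε i • y i‖ ^ 2 := by
      rcases le_total (inner ℝ (y j) (∑ i ∈ s, ε i • y i)) 0 with h0 | h0
      · exact ⟨1, by simp, by rw [one_smul, norm_add_sq_real]; linarith⟩
      · exact ⟨-1, by simp, by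
          rw [neg_one_smul, norm_add_sq_real, inner_neg_left, norm_neg]; linarith⟩
    obtain ⟨c, hc, hle⟩ := key
    refine ⟨Function.update ε j c, fun i => ?_, ?_⟩
    · by_cases hi : i = j
      · subst hi; simpa using hc
      · simpa [hi] using hε i
    · have hsum : ∑ i ∈ s, Function.update ε j c i • y i = ∑ i ∈ s, ε i • y i :=
        Finset.sum_congr rfl fun i hi => by
          rw [Function.update_of_ne (ne_of_mem_of_not_mem hi hj)]
      rw [Finset.sum_insert hj, Finset.sum_insert hj, Function.update_self, hsum]
      linarith

theorem exists_signs_le_norm_sum_sq (y : ι → E) (s : Finset ι) :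
    ∃ ε : ι → ℝ, (∀ i, |ε i| = 1) ∧ ∑ i ∈ s, ‖y i‖ ^ 2 ≤ ‖∑ i ∈ s, ε i • y i‖ ^ 2 := by
  classical
  induction s using Finset.induction_on with
  | empty => exact ⟨fun _ => 1, by simp, by simp⟩
  | insert j s hj ih =>
    obtain ⟨ε, hε, h⟩ := ih
    have key : ∃ c : ℝ, |c| = 1 ∧
        ‖y j‖ ^ 2 + ‖∑ i ∈ s, ε i • y i‖ ^ 2 ≤ ‖c • y j + ∑ i ∈ s, ε i • y i‖ ^ 2 := by
      rcases le_total 0 (inner ℝ (y j) (∑ i ∈ s, ε i • y i)) with h0 | h0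
      · exact ⟨1, by simp, by rw [one_smul, norm_add_sq_real]; linarith⟩
      · exact ⟨-1, by simp, by
          rw [neg_one_smul, norm_add_sq_real, inner_neg_left, norm_neg]; linarith⟩
    obtain ⟨c, hc, hle⟩ := key
    refine ⟨Function.update ε j c, fun i => ?_, ?_⟩
    · by_cases hi : i = j
      · subst hi; simpa using hc
      · simpa [hi] using hε i
    · have hsum : ∑ i ∈ s, Function.update ε j c i • y i = ∑ i ∈ s, ε i • y i :=
        Finset.sum_congr rfl fun i hi => by
          rw [Function.update_of_ne (ne_of_mem_of_not_mem hi hj)]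
      rw [Finset.sum_insert hj, Finset.sum_insert hj, Function.update_self, hsum]
      linarith

end Signs

/-! ### Banach–Mazur distance and nearly optimal maps -/

section BanachMazur

variable {X Y : Type*} [NormedAddCommGroup X] [NormedSpace ℝ X] [NormedAddCommGroup Y]
  [NormedSpace ℝ Y]

theorem banachMazurDist_le_norm_mul_norm (T : X ≃L[ℝ] Y) :
    banachMazurDist X Y ≤ ‖(T : X →L[ℝ] Y)‖ * ‖(T.symm : Y →L[ℝ] X)‖ :=
  ciInf_le ⟨0, by rintro _ ⟨S, rfl⟩; positivity⟩ T

theorem banachMazurDist_le_mul [FiniteDimensional ℝ X] (T : X ≃ₗ[ℝ] Y) {A B : ℝ} (hA : 0 ≤ A)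
    (hB : 0 ≤ B) (h₁ : ∀ x, ‖T x‖ ≤ A * ‖x‖) (h₂ : ∀ x, ‖x‖ ≤ B * ‖T x‖) :
    banachMazurDist X Y ≤ A * B := by
  refine (banachMazurDist_le_norm_mul_norm T.toContinuousLinearEquiv).trans ?_
  refine mul_le_mul ?_ ?_ (norm_nonneg _) hA
  · exact ContinuousLinearMap.opNorm_le_bound _ hA h₁
  · refine ContinuousLinearMap.opNorm_le_bound _ hB fun y => ?_
    simpa using h₂ (T.symm y)

theorem one_le_banachMazurDist [Nontrivial X] [Nonempty (X ≃L[ℝ] Y)] :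
    1 ≤ banachMazurDist X Y :=
  le_ciInf fun T => T.one_le_norm_mul_norm_symm

/-- Dividing a nearly optimal map by its norm puts all the distortion on the inverse. The strict
inequality avoids needing the infimum to be attained. -/
theorem exists_linearEquiv_contracting [Nontrivial X] [Nonempty (X ≃L[ℝ] Y)] {c : ℝ}
    (hc : banachMazurDist X Y < c) :
    ∃ T : X ≃ₗ[ℝ] Y, ∀ x, ‖T x‖ ≤ ‖x‖ ∧ ‖x‖ ≤ c * ‖T x‖ := by
  obtain ⟨T, hT⟩ := exists_lt_of_ciInf_lt hc
  have hpos : 0 < ‖(T : X →L[ℝ] Y)‖ := T.norm_pos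
  refine ⟨T.toLinearEquiv.trans (LinearEquiv.smulOfNeZero ℝ Y _ (inv_ne_zero hpos.ne')),
    fun x => ?_⟩
  have h1 : ‖T x‖ ≤ ‖(T : X →L[ℝ] Y)‖ * ‖x‖ := (T : X →L[ℝ] Y).le_opNorm x
  have h2 : ‖x‖ ≤ ‖(T.symm : Y →L[ℝ] X)‖ * ‖T x‖ := by
    simpa using (T.symm : Y →L[ℝ] X).le_opNorm (T x)
  have h3 : ‖(T.toLinearEquiv.trans
      (LinearEquiv.smulOfNeZero ℝ Y _ (inv_ne_zero hpos.ne'))) x‖ =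
      ‖(T : X →L[ℝ] Y)‖⁻¹ * ‖T x‖ := by
    simp [norm_smul]
  rw [h3]
  constructor
  · rwa [inv_mul_le_iff₀ hpos]
  · calc ‖x‖ ≤ ‖(T.symm : Y →L[ℝ] X)‖ * ‖T x‖ := h2
      _ = (‖(T : X →L[ℝ] Y)‖ * ‖(T.symm : Y →L[ℝ] X)‖) *
          (‖(T : X →L[ℝ] Y)‖⁻¹ * ‖T x‖) := by field_simp
      _ ≤ _ := by gcongr

theorem exists_linearEquiv_expanding [Nontrivial X] [Nonempty (X ≃L[ℝ] Y)] {c : ℝ}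
    (hc : banachMazurDist X Y < c) :
    ∃ T : X ≃ₗ[ℝ] Y, ∀ x, ‖T x‖ ≤ c * ‖x‖ ∧ ‖x‖ ≤ ‖T x‖ := by
  have hc0 : 0 < c := zero_lt_one.trans_le (one_le_banachMazurDist.trans hc.le)
  obtain ⟨T, hT⟩ := exists_linearEquiv_contracting hc
  refine ⟨T.trans (LinearEquiv.smulOfNeZero ℝ Y c hc0.ne'), fun x => ?_⟩
  have h : ‖(T.trans (LinearEquiv.smulOfNeZero ℝ Y c hc0.ne')) x‖ = c * ‖T x‖ := by
    simp [norm_smul, abs_of_pos hc0]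
  rw [h]
  exact ⟨mul_le_mul_of_nonneg_left (hT x).1 hc0.le, (hT x).2⟩

/-- A linear embedding into an inner product space distorts some pair of unit vectors by at least
the Banach--Mazur distance to Euclidean space. -/
theorem exists_unit_banachMazurDist_mul_le {F : Type*} [NormedAddCommGroup F]
    [InnerProductSpace ℝ F] [FiniteDimensional ℝ X] [Nontrivial X] {m : ℕ}
    (hm : Module.finrank ℝ X = m) (T : X →ₗ[ℝ] F) (hT : Function.Injective T) :
    ∃ u v : X, ‖u‖ = 1 ∧ ‖v‖ = 1 ∧
      banachMazurDist X (EuclideanSpace ℝ (Fin m)) * ‖T v‖ ≤ ‖T u‖ := by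
  have hcont : Continuous fun x => ‖T x‖ := T.continuous_of_finiteDimensional.norm
  have := FiniteDimensional.proper ℝ X
  have hne : (Metric.sphere (0 : X) 1).Nonempty := NormedSpace.sphere_nonempty.2 zero_le_one
  obtain ⟨u, hu, hmax⟩ := (isCompact_sphere (0 : X) 1).exists_isMaxOn hne hcont.continuousOn
  obtain ⟨v, hv, hmin⟩ := (isCompact_sphere (0 : X) 1).exists_isMinOn hne hcont.continuousOn
  rw [mem_sphere_zero_iff_norm] at hu hv
  have hv0 : v ≠ 0 := by rintro rfl; simp at hv
  have hβ : 0 < ‖T v‖ := norm_pos_iff.2 fun h => hv0 (hT (by rw [h, map_zero]))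
  have hscale : ∀ x : X, x ≠ 0 → ‖x‖⁻¹ • x ∈ Metric.sphere (0 : X) 1 ∧
      ‖T (‖x‖⁻¹ • x)‖ = ‖x‖⁻¹ * ‖T x‖ := fun x hx => by
    have : ‖x‖ ≠ 0 := norm_ne_zero_iff.2 hx
    simp [norm_smul, this]
  have hup : ∀ x, ‖T x‖ ≤ ‖T u‖ * ‖x‖ := fun x => by
    by_cases hx : x = 0
    · simp [hx]
    · have h : ‖T (‖x‖⁻¹ • x)‖ ≤ ‖T u‖ := hmax (hscale x hx).1
      rwa [(hscale x hx).2, inv_mul_le_iff₀ (norm_pos_iff.2 hx), mul_comm] at h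
  have hlow : ∀ x, ‖x‖ ≤ ‖T v‖⁻¹ * ‖T x‖ := fun x => by
    by_cases hx : x = 0
    · simp [hx]
    · have h : ‖T v‖ ≤ ‖T (‖x‖⁻¹ • x)‖ := hmin (hscale x hx).1
      rw [(hscale x hx).2, le_inv_mul_iff₀ (norm_pos_iff.2 hx)] at h
      rwa [le_inv_mul_iff₀ hβ, mul_comm]
  -- `F` may be larger than `X`; an orthonormal basis identifies the range of `T` isometrically with
  -- Euclidean space.
  let e : X ≃ₗ[ℝ] LinearMap.range T := LinearEquiv.ofInjective T hT
  have hfin : Module.finrank ℝ (LinearMap.range T) = m := by rw [← e.finrank_eq, hm]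
  let g : LinearMap.range T ≃ₗᵢ[ℝ] EuclideanSpace ℝ (Fin m) :=
    ((stdOrthonormalBasis ℝ (LinearMap.range T)).reindex (finCongr hfin)).repr
  have hnorm : ∀ x, ‖(e.trans g.toLinearEquiv) x‖ = ‖T x‖ := fun x => by
    change ‖g (e x)‖ = _
    rw [g.norm_map]
    rfl
  refine ⟨u, v, hu, hv, ?_⟩
  rw [← le_div_iff₀ hβ, div_eq_mul_inv]
  exact banachMazurDist_le_mul (e.trans g.toLinearEquiv) (norm_nonneg _) (inv_nonneg.2 hβ.le)
    (fun x => by rw [hnorm]; exact hup x) fun x => by rw [hnorm]; exact hlow x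

end BanachMazur

theorem le_of_forall_le_const_mul {a D : ℝ} (hD : 0 ≤ D) (h : ∀ c, 1 < c → a ≤ c * D) :
    a ≤ D := by
  refine le_of_forall_pos_le_add fun ε hε => ?_
  -- The denominator `D + 1` also covers `D = 0`.
  have h0 : 0 < ε / (D + 1) := by positivity
  have h1 := h (1 + ε / (D + 1)) (by linarith)
  have h2 : ε / (D + 1) * D ≤ ε := by
    rw [div_mul_eq_mul_div, div_le_iff₀ (by positivity)]
    nlinarith
  linarith

/-! ### Block maps and sign combinations in `ℓ_p`-sums -/

section DirectSum

variable {ι : Type*} [Fintype ι] {X : ι → Type*} [∀ i, NormedAddCommGroup (X i)]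
  [∀ i, NormedSpace ℝ (X i)]

theorem exists_block_linearEquiv {E : ι → Type*} [∀ i, NormedAddCommGroup (E i)]
    [∀ i, NormedSpace ℝ (E i)] (p : ℝ≥0∞) [Fact (1 ≤ p)] (T : ∀ i, X i ≃ₗ[ℝ] E i) :
    ∃ S : PiLp p X ≃ₗ[ℝ] PiLp 2 E, ∀ x, ‖S x‖ = lpNorm 2 fun i => ‖T i (x i)‖ :=
  ⟨((WithLp.linearEquiv p ℝ (∀ i, X i)).trans (LinearEquiv.piCongrRight T)).trans
    (WithLp.linearEquiv 2 ℝ (∀ i, E i)).symm, fun x => by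
      rw [norm_piLp_eq_lpNorm]
      rfl⟩

section Diagonal

variable {F : Type*} [NormedAddCommGroup F] [InnerProductSpace ℝ F] {p : ℝ≥0∞}

theorem lpNorm_norm_smul_unit [Fact (1 ≤ p)] {w : ∀ i, X i} (hw : ∀ i, ‖w i‖ = 1) {ε : ι → ℝ}
    (hε : ∀ i, |ε i| = 1) (t : ι → ℝ) :
    ‖(WithLp.toLp p fun i => (ε i * t i) • w i : PiLp p X)‖ = lpNorm p t := by
  rw [norm_piLp_eq_lpNorm]
  apply le_antisymm <;> refine lpNorm_mono p fun i => ?_ <;> simp [norm_smul, hw, hε]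

variable [DecidableEq ι]

theorem map_toLp_eq_sum (T : PiLp p X →ₗ[ℝ] F) (w : ∀ i, X i) (ε t : ι → ℝ) :
    T (WithLp.toLp p fun i => (ε i * t i) • w i) =
      ∑ i, ε i • t i • T (PiLp.single p i (w i)) := by
  have h : (WithLp.toLp p fun i => (ε i * t i) • w i : PiLp p X) =
      ∑ i, ε i • t i • PiLp.single p i (w i) := by
    ext j
    rw [WithLp.ofLp_sum, Finset.sum_apply, Finset.sum_eq_single j]
    · simp [mul_smul]
    · intro i _ hij
      simp [Ne.symm hij]
    · simp
  rw [h, map_sum]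
  simp

variable [Fact (1 ≤ p)]

/-- Apply `T` to the combination of the `w i` whose signs make the image large; its norm in the sum
is `lpNorm p t` whatever the signs. -/
theorem lpNorm_two_mul_norm_le (T : PiLp p X →L[ℝ] F) {w : ∀ i, X i} (hw : ∀ i, ‖w i‖ = 1)
    (t : ι → ℝ) :
    lpNorm 2 (fun i => t i * ‖T (PiLp.single p i (w i))‖) ≤ ‖T‖ * lpNorm p t := by
  obtain ⟨ε, hε, h⟩ :=
    exists_signs_le_norm_sum_sq (fun i => t i • T (PiLp.single p i (w i))) Finset.univ
  have hmap := map_toLp_eq_sum (T : PiLp p X →ₗ[ℝ] F) w ε t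
  simp only [ContinuousLinearMap.coe_coe] at hmap
  have hle := T.le_opNorm (WithLp.toLp p fun i => (ε i * t i) • w i)
  rw [lpNorm_norm_smul_unit hw hε] at hle
  refine le_trans ?_ hle
  rw [← abs_of_nonneg (lpNorm_nonneg 2 _), ← abs_norm (T _), ← sq_le_sq, lpNorm_two_sq, hmap]
  simpa [norm_smul, mul_pow] using h

/-- Here the signs are chosen to make the image small, and the inverse is applied. -/
theorem lpNorm_le_mul_lpNorm_two (T : PiLp p X ≃L[ℝ] F) {w : ∀ i, X i} (hw : ∀ i, ‖w i‖ = 1)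
    (t : ι → ℝ) :
    lpNorm p t ≤ ‖(T.symm : F →L[ℝ] PiLp p X)‖ *
      lpNorm 2 (fun i => t i * ‖T (PiLp.single p i (w i))‖) := by
  obtain ⟨ε, hε, h⟩ :=
    exists_signs_norm_sum_sq_le (fun i => t i • T (PiLp.single p i (w i))) Finset.univ
  have hmap := map_toLp_eq_sum (T.toLinearEquiv : PiLp p X →ₗ[ℝ] F) w ε t
  simp only [LinearEquiv.coe_coe, ContinuousLinearEquiv.coe_toLinearEquiv] at hmap
  have hle := (T.symm : F →L[ℝ] PiLp p X).le_opNorm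
    (T (WithLp.toLp p fun i => (ε i * t i) • w i))
  rw [ContinuousLinearEquiv.coe_coe, T.symm_apply_apply, lpNorm_norm_smul_unit hw hε] at hle
  refine hle.trans (mul_le_mul_of_nonneg_left ?_ (norm_nonneg _))
  rw [← abs_of_nonneg (lpNorm_nonneg 2 _), ← abs_norm (T _), ← sq_le_sq, lpNorm_two_sq, hmap]
  simpa [norm_smul, mul_pow] using h

end Diagonal

end DirectSum

/-! ### Upper and lower bounds by diagonal operators -/

section LpSum

variable {k : ℕ} {n : Fin k → ℕ} {X : Fin k → Type*} [∀ i, NormedAddCommGroup (X i)]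
  [∀ i, NormedSpace ℝ (X i)]

theorem lpSumDist_nonneg (p : ℝ≥0∞) [Fact (1 ≤ p)] : 0 ≤ lpSumDist n X p :=
  Real.iInf_nonneg fun _ => by positivity

theorem exists_block_linearEquiv_euclidean (p : ℝ≥0∞) [Fact (1 ≤ p)]
    (T : ∀ i, X i ≃ₗ[ℝ] EuclideanSpace ℝ (Fin (n i))) :
    ∃ S : PiLp p X ≃ₗ[ℝ] EuclideanSpace ℝ (Fin (∑ i, n i)),
      ∀ x, ‖S x‖ = lpNorm 2 fun i => ‖T i (x i)‖ := by
  obtain ⟨S, hS⟩ := exists_block_linearEquiv p T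
  have hfin : Module.finrank ℝ (PiLp 2 fun i => EuclideanSpace ℝ (Fin (n i))) = ∑ i, n i := by
    rw [(WithLp.linearEquiv 2 ℝ (∀ i, EuclideanSpace ℝ (Fin (n i)))).finrank_eq,
      Module.finrank_pi_fintype]
    simp
  let g : (PiLp 2 fun i => EuclideanSpace ℝ (Fin (n i))) ≃ₗᵢ[ℝ]
      EuclideanSpace ℝ (Fin (∑ i, n i)) :=
    ((stdOrthonormalBasis ℝ _).reindex (finCongr hfin)).repr
  refine ⟨S.trans g.toLinearEquiv, fun x => ?_⟩
  rw [← hS]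
  exact g.norm_map (S x)

variable [∀ i, FiniteDimensional ℝ (X i)]

theorem lpSumDist_le_of_distortion {p : ℝ≥0∞} [Fact (1 ≤ p)]
    (T : ∀ i, X i ≃ₗ[ℝ] EuclideanSpace ℝ (Fin (n i))) {A B : ℝ} (hA : 0 ≤ A) (hB : 0 ≤ B)
    (h₁ : ∀ x : ∀ i, X i, lpNorm 2 (fun i => ‖T i (x i)‖) ≤ A * lpNorm p fun i => ‖x i‖)
    (h₂ : ∀ x : ∀ i, X i, lpNorm p (fun i => ‖x i‖) ≤ B * lpNorm 2 fun i => ‖T i (x i)‖) :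
    lpSumDist n X p ≤ A * B := by
  obtain ⟨S, hS⟩ := exists_block_linearEquiv_euclidean p T
  have : FiniteDimensional ℝ (PiLp p X) :=
    (WithLp.linearEquiv p ℝ (∀ i, X i)).symm.finiteDimensional
  refine banachMazurDist_le_mul S hA hB (fun x => ?_) fun x => ?_
  · rw [hS, norm_piLp_eq_lpNorm]
    exact h₁ fun i => x i
  · rw [hS, norm_piLp_eq_lpNorm]
    exact h₂ fun i => x i

theorem nonempty_continuousLinearEquiv_euclidean (hX : ∀ i, Module.finrank ℝ (X i) = n i)
    (i : Fin k) : Nonempty (X i ≃L[ℝ] EuclideanSpace ℝ (Fin (n i))) :=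
  ⟨ContinuousLinearEquiv.ofFinrankEq (by simp [hX])⟩

variable [∀ i, Nontrivial (X i)] {d : Fin k → ℝ}

theorem one_le_of_eq_banachMazurDist (hX : ∀ i, Module.finrank ℝ (X i) = n i)
    (hd : ∀ i, d i = banachMazurDist (X i) (EuclideanSpace ℝ (Fin (n i)))) (i : Fin k) :
    1 ≤ d i := by
  have := nonempty_continuousLinearEquiv_euclidean hX i
  exact hd i ▸ one_le_banachMazurDist

/-- With contracting block maps the forward norm is at most `1`, as `‖·‖₂ ≤ ‖·‖_p`; only the inverse
sees the `d i`. -/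
theorem lpSumDist_le_of_le_two (hX : ∀ i, Module.finrank ℝ (X i) = n i)
    (hd : ∀ i, d i = banachMazurDist (X i) (EuclideanSpace ℝ (Fin (n i))))
    {p : ℝ≥0∞} [Fact (1 ≤ p)] (hp : p ≤ 2) {D : ℝ} (hD : 0 ≤ D) (h : DiagBound d 2 p D) :
    lpSumDist n X p ≤ D := by
  refine le_of_forall_le_const_mul hD fun c hc => ?_
  have hd1 := one_le_of_eq_banachMazurDist hX hd
  have hT : ∀ i, ∃ T : X i ≃ₗ[ℝ] EuclideanSpace ℝ (Fin (n i)),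
      ∀ x, ‖T x‖ ≤ ‖x‖ ∧ ‖x‖ ≤ c * d i * ‖T x‖ := fun i => by
    have := nonempty_continuousLinearEquiv_euclidean hX i
    exact exists_linearEquiv_contracting (by rw [← hd]; nlinarith [hd1 i])
  choose T hT using hT
  rw [← one_mul (c * D)]
  refine lpSumDist_le_of_distortion T zero_le_one (by positivity) (fun x => ?_) fun x => ?_
  · rw [one_mul]
    exact (lpNorm_mono 2 fun i => by simpa using (hT i (x i)).1).trans (lpNorm_anti hp _)
  · calc lpNorm p (fun i => ‖x i‖) ≤ lpNorm p (c • fun i => d i * ‖T i (x i)‖) :=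
          lpNorm_mono p fun i => by
            rw [abs_norm]
            refine le_trans ?_ (le_abs_self _)
            simpa [mul_assoc] using (hT i (x i)).2
      _ = c * lpNorm p (fun i => d i * ‖T i (x i)‖) := by
          rw [lpNorm_smul, abs_of_pos (by positivity)]
      _ ≤ c * (D * lpNorm 2 fun i => ‖T i (x i)‖) := by
          gcongr
          exact h _
      _ = _ := by ring

/-- Now `‖·‖_p ≤ ‖·‖₂`, so expanding block maps are used and the forward map carries the `d i`. -/
theorem lpSumDist_le_of_two_le (hX : ∀ i, Module.finrank ℝ (X i) = n i)
    (hd : ∀ i, d i = banachMazurDist (X i) (EuclideanSpace ℝ (Fin (n i))))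
    {p : ℝ≥0∞} [Fact (1 ≤ p)] (hp : 2 ≤ p) {D : ℝ} (hD : 0 ≤ D) (h : DiagBound d p 2 D) :
    lpSumDist n X p ≤ D := by
  refine le_of_forall_le_const_mul hD fun c hc => ?_
  have hd1 := one_le_of_eq_banachMazurDist hX hd
  have hT : ∀ i, ∃ T : X i ≃ₗ[ℝ] EuclideanSpace ℝ (Fin (n i)),
      ∀ x, ‖T x‖ ≤ c * d i * ‖x‖ ∧ ‖x‖ ≤ ‖T x‖ := fun i => by
    have := nonempty_continuousLinearEquiv_euclidean hX i
    exact exists_linearEquiv_expanding (by rw [← hd]; nlinarith [hd1 i])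
  choose T hT using hT
  rw [← mul_one (c * D)]
  refine lpSumDist_le_of_distortion T (by positivity) zero_le_one (fun x => ?_) fun x => ?_
  · calc lpNorm 2 (fun i => ‖T i (x i)‖) ≤ lpNorm 2 (c • fun i => d i * ‖x i‖) :=
          lpNorm_mono 2 fun i => by
            rw [abs_norm]
            refine le_trans ?_ (le_abs_self _)
            simpa [mul_assoc] using (hT i (x i)).1
      _ = c * lpNorm 2 (fun i => d i * ‖x i‖) := by
          rw [lpNorm_smul, abs_of_pos (by positivity)]
      _ ≤ c * (D * lpNorm p fun i => ‖x i‖) := by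
          gcongr
          exact h _
      _ = _ := by ring
  · rw [one_mul]
    exact (lpNorm_anti hp _).trans (lpNorm_mono 2 fun i => by simpa using (hT i (x i)).2)

theorem diagBound_lpSumDist_of_forall (hX : ∀ i, Module.finrank ℝ (X i) = n i)
    {p q r : ℝ≥0∞} [Fact (1 ≤ p)] [Fact (1 ≤ q)] [Fact (1 ≤ r)]
    (h : ∀ S : PiLp p X ≃L[ℝ] EuclideanSpace ℝ (Fin (∑ i, n i)), DiagBound d q r
      (‖(S : PiLp p X →L[ℝ] EuclideanSpace ℝ (Fin (∑ i, n i)))‖ *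
        ‖(S.symm : EuclideanSpace ℝ (Fin (∑ i, n i)) →L[ℝ] PiLp p X)‖)) :
    DiagBound d q r (lpSumDist n X p) := by
  intro t
  by_cases ht : t = 0
  · have h0 : (fun i => d i * t i) = 0 := by ext i; simp [ht]
    rw [h0, ht, lpNorm_zero, lpNorm_zero, mul_zero]
  have hpos := lpNorm_pos q ht
  have : FiniteDimensional ℝ (PiLp p X) :=
    (WithLp.linearEquiv p ℝ (∀ i, X i)).symm.finiteDimensional
  have : Nonempty (PiLp p X ≃L[ℝ] EuclideanSpace ℝ (Fin (∑ i, n i))) :=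
    ⟨ContinuousLinearEquiv.ofFinrankEq (by
      rw [(WithLp.linearEquiv p ℝ (∀ i, X i)).finrank_eq, Module.finrank_pi_fintype]
      simp [hX])⟩
  rw [← div_le_iff₀ hpos]
  exact le_ciInf fun S => (div_le_iff₀ hpos).2 (h S t)

theorem exists_units_mul_le (hX : ∀ i, Module.finrank ℝ (X i) = n i)
    (hd : ∀ i, d i = banachMazurDist (X i) (EuclideanSpace ℝ (Fin (n i))))
    {p : ℝ≥0∞} [Fact (1 ≤ p)] {F : Type*} [NormedAddCommGroup F] [InnerProductSpace ℝ F]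
    (S : PiLp p X ≃L[ℝ] F) :
    ∃ u v : ∀ i, X i, (∀ i, ‖u i‖ = 1) ∧ (∀ i, ‖v i‖ = 1) ∧
      ∀ i, d i * ‖S (PiLp.single p i (v i))‖ ≤ ‖S (PiLp.single p i (u i))‖ := by
  have h : ∀ i, ∃ u v : X i, ‖u‖ = 1 ∧ ‖v‖ = 1 ∧
      d i * ‖S (PiLp.single p i v)‖ ≤ ‖S (PiLp.single p i u)‖ := fun i => by
    rw [hd]
    refine exists_unit_banachMazurDist_mul_le (hX i)
      ((S.toLinearEquiv : PiLp p X →ₗ[ℝ] F) ∘ₗ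
        ((WithLp.linearEquiv p ℝ (∀ i, X i)).symm : (∀ i, X i) →ₗ[ℝ] PiLp p X) ∘ₗ
        LinearMap.single ℝ X i) ?_
    intro x y hxy
    have h := congrArg (fun z : PiLp p X => z i) (S.injective hxy)
    simpa using h
  choose u v hu hv huv using h
  exact ⟨u, v, hu, hv, huv⟩

/-- Apply the small-image signs to the `v i` with coefficients `d i * t i`; then `d i * ‖S (v i)‖ ≤
‖S (u i)‖ ≤ ‖S‖` absorbs the diagonal. -/
theorem diagBound_two_left_lpSumDist (hX : ∀ i, Module.finrank ℝ (X i) = n i)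
    (hd : ∀ i, d i = banachMazurDist (X i) (EuclideanSpace ℝ (Fin (n i))))
    {p : ℝ≥0∞} [Fact (1 ≤ p)] : DiagBound d 2 p (lpSumDist n X p) := by
  refine diagBound_lpSumDist_of_forall hX fun S t => ?_
  obtain ⟨u, v, hu, hv, huv⟩ := exists_units_mul_le hX hd S
  have hd1 := one_le_of_eq_banachMazurDist hX hd
  have hα : ∀ i, ‖S (PiLp.single p i (u i))‖ ≤
      ‖(S : PiLp p X →L[ℝ] EuclideanSpace ℝ (Fin (∑ i, n i)))‖ := fun i => by
    simpa [hu] using (S : PiLp p X →L[ℝ] EuclideanSpace ℝ (Fin (∑ i, n i))).le_opNorm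
      (PiLp.single p i (u i))
  set A := ‖(S : PiLp p X →L[ℝ] EuclideanSpace ℝ (Fin (∑ i, n i)))‖
  refine (lpNorm_le_mul_lpNorm_two S hv _).trans ?_
  rw [mul_comm A, mul_assoc]
  refine mul_le_mul_of_nonneg_left ?_ (norm_nonneg _)
  calc lpNorm 2 (fun i => d i * t i * ‖S (PiLp.single p i (v i))‖) ≤ lpNorm 2 (A • t) :=
        lpNorm_mono 2 fun i => by
          have h1 : |d i * t i * ‖S (PiLp.single p i (v i))‖| =
              d i * ‖S (PiLp.single p i (v i))‖ * |t i| := by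
            rw [abs_mul, abs_mul, abs_norm, abs_of_pos (by linarith [hd1 i])]
            ring
          rw [h1, Pi.smul_apply, smul_eq_mul, abs_mul, abs_of_nonneg (norm_nonneg _)]
          gcongr
          exact (huv i).trans (hα i)
    _ = A * lpNorm 2 t := by rw [lpNorm_smul, abs_of_nonneg (norm_nonneg _)]

/-- Since `1 ≤ ‖S⁻¹‖ * ‖S (v i)‖`, each `d i` is at most `‖S⁻¹‖ * ‖S (u i)‖`; the large-image signs
for the `u i` finish. -/
theorem diagBound_two_right_lpSumDist (hX : ∀ i, Module.finrank ℝ (X i) = n i)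
    (hd : ∀ i, d i = banachMazurDist (X i) (EuclideanSpace ℝ (Fin (n i))))
    {p : ℝ≥0∞} [Fact (1 ≤ p)] : DiagBound d p 2 (lpSumDist n X p) := by
  refine diagBound_lpSumDist_of_forall hX fun S t => ?_
  obtain ⟨u, v, hu, hv, huv⟩ := exists_units_mul_le hX hd S
  have hd1 := one_le_of_eq_banachMazurDist hX hd
  have hβ : ∀ i, 1 ≤ ‖(S.symm : EuclideanSpace ℝ (Fin (∑ i, n i)) →L[ℝ] PiLp p X)‖ *
      ‖S (PiLp.single p i (v i))‖ := fun i => by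
    simpa [hv] using (S.symm : EuclideanSpace ℝ (Fin (∑ i, n i)) →L[ℝ] PiLp p X).le_opNorm
      (S (PiLp.single p i (v i)))
  set B := ‖(S.symm : EuclideanSpace ℝ (Fin (∑ i, n i)) →L[ℝ] PiLp p X)‖
  have hB : 0 ≤ B := norm_nonneg _
  calc lpNorm 2 (fun i => d i * t i)
      ≤ lpNorm 2 (B • fun i => t i * ‖S (PiLp.single p i (u i))‖) :=
        lpNorm_mono 2 fun i => by
          have h1 : |(B • fun i => t i * ‖S (PiLp.single p i (u i))‖) i| =
              B * ‖S (PiLp.single p i (u i))‖ * |t i| := by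
            rw [Pi.smul_apply, smul_eq_mul, abs_mul, abs_of_nonneg hB, abs_mul, abs_norm]
            ring
          rw [h1, abs_mul, abs_of_pos (by linarith [hd1 i])]
          gcongr
          calc d i = d i * 1 := (mul_one _).symm
            _ ≤ d i * (B * ‖S (PiLp.single p i (v i))‖) :=
                mul_le_mul_of_nonneg_left (hβ i) (by linarith [hd1 i])
            _ = B * (d i * ‖S (PiLp.single p i (v i))‖) := by ring
            _ ≤ _ := mul_le_mul_of_nonneg_left (huv i) hB
    _ = B * lpNorm 2 (fun i => t i * ‖S (PiLp.single p i (u i))‖) := by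
        rw [lpNorm_smul, abs_of_nonneg hB]
    _ ≤ B * (‖(S : PiLp p X →L[ℝ] EuclideanSpace ℝ (Fin (∑ i, n i)))‖ * lpNorm p t) := by
        gcongr
        exact lpNorm_two_mul_norm_le (S : PiLp p X →L[ℝ] EuclideanSpace ℝ (Fin (∑ i, n i))) hu t
    _ = _ := by ring

end LpSum

/-! ### Diagonal norms at the endpoints and the resulting values of `f` -/

theorem DiagBound.abs_le {ι : Type*} [Fintype ι] {d : ι → ℝ} {p r : ℝ≥0∞} [Fact (1 ≤ p)]
    [Fact (1 ≤ r)] {D : ℝ} (h : DiagBound d p r D) (i : ι) : |d i| ≤ D := by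
  classical
  have h1 := (abs_apply_le_lpNorm r _ i).trans (h (Pi.single i 1))
  simpa [lpNorm_single] using h1

theorem diagBound_top_two {ι : Type*} [Fintype ι] (d : ι → ℝ) :
    DiagBound d ∞ 2 (lpNorm 2 d) := by
  intro t
  rw [mul_comm, ← abs_of_nonneg (lpNorm_nonneg ∞ t), ← lpNorm_smul]
  refine lpNorm_mono 2 fun i => ?_
  rw [Pi.smul_apply, smul_eq_mul, abs_mul, abs_mul, mul_comm, abs_of_nonneg (lpNorm_nonneg ∞ t)]
  exact mul_le_mul_of_nonneg_right (abs_apply_le_lpNorm ∞ t i) (abs_nonneg _)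

theorem diagBound_two_one {ι : Type*} [Fintype ι] (d : ι → ℝ) :
    DiagBound d 2 1 (lpNorm 2 d) := by
  intro t
  rw [lpNorm_one]
  have h : ∀ s : ι → ℝ, lpNorm 2 (fun i => |s i|) ≤ lpNorm 2 s := fun s =>
    lpNorm_mono 2 fun i => by simp
  calc ∑ i, |d i * t i| = ∑ i, |d i| * |t i| := by simp [abs_mul]
    _ ≤ lpNorm 2 (fun i => |d i|) * lpNorm 2 fun i => |t i| := sum_mul_le_lpNorm_two _ _
    _ ≤ _ := mul_le_mul (h d) (h t) (lpNorm_nonneg _ _) (lpNorm_nonneg _ _)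

section LpSum

variable {k : ℕ} {n : Fin k → ℕ} {X : Fin k → Type*} [∀ i, NormedAddCommGroup (X i)]
  [∀ i, NormedSpace ℝ (X i)] [∀ i, FiniteDimensional ℝ (X i)] [∀ i, Nontrivial (X i)]
  {d : Fin k → ℝ}

theorem lpSumDist_top_eq (hX : ∀ i, Module.finrank ℝ (X i) = n i)
    (hd : ∀ i, d i = banachMazurDist (X i) (EuclideanSpace ℝ (Fin (n i)))) :
    lpSumDist n X ∞ = lpNorm 2 d := by
  refine le_antisymm (lpSumDist_le_of_two_le hX hd le_top (lpNorm_nonneg _ _)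
    (diagBound_top_two d)) ?_
  -- The all-ones vector is extremal from `ℓ_∞` to `ℓ_2`.
  have h := diagBound_two_right_lpSumDist hX hd (p := ∞) fun _ => 1
  simp only [mul_one] at h
  refine h.trans (mul_le_of_le_one_right (lpSumDist_nonneg ∞) ?_)
  exact lpNorm_top_le zero_le_one fun i => by simp

theorem lpSumDist_one_eq (hX : ∀ i, Module.finrank ℝ (X i) = n i)
    (hd : ∀ i, d i = banachMazurDist (X i) (EuclideanSpace ℝ (Fin (n i)))) :
    lpSumDist n X 1 = lpNorm 2 d := by
  refine le_antisymm (lpSumDist_le_of_le_two hX hd (by norm_num) (lpNorm_nonneg _ _)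
    (diagBound_two_one d)) ?_
  by_cases hd0 : d = 0
  · rw [hd0, lpNorm_zero]
    exact lpSumDist_nonneg 1
  -- Equality in Cauchy–Schwarz: the diagonal is tested on `d` itself.
  · have h := diagBound_two_left_lpSumDist hX hd (p := 1) d
    have h1 : lpNorm 1 (fun i => d i * d i) = lpNorm 2 d * lpNorm 2 d := by
      rw [← sq, lpNorm_two_sq, lpNorm_one]
      exact Finset.sum_congr rfl fun i _ => by rw [abs_mul_self, sq]
    rw [h1] at h
    exact le_of_mul_le_mul_right h (lpNorm_pos 2 hd0)

theorem lpSumDist_le_one (hX : ∀ i, Module.finrank ℝ (X i) = n i)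
    (hd : ∀ i, d i = banachMazurDist (X i) (EuclideanSpace ℝ (Fin (n i))))
    (p : ℝ≥0∞) [hp : Fact (1 ≤ p)] : lpSumDist n X p ≤ lpSumDist n X 1 := by
  rw [lpSumDist_one_eq hX hd]
  have h0 := lpNorm_nonneg 2 d
  rcases le_total p 2 with h | h
  · exact lpSumDist_le_of_le_two hX hd h h0 fun t =>
      (lpNorm_anti hp.out _).trans (diagBound_two_one d t)
  · exact lpSumDist_le_of_two_le hX hd h h0 fun t => (diagBound_top_two d t).trans
      (mul_le_mul_of_nonneg_left (lpNorm_anti le_top t) h0)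

/-- The lower bound at one exponent, transposed by duality, is exactly the hypothesis of the upper
bound at the other. The pair `1, ∞` is settled by explicit values, since the duality lemmas need
finite exponents. -/
theorem lpSumDist_eq_of_le_two (hX : ∀ i, Module.finrank ℝ (X i) = n i)
    (hd : ∀ i, d i = banachMazurDist (X i) (EuclideanSpace ℝ (Fin (n i))))
    {p q : ℝ≥0∞} [Fact (1 ≤ p)] [Fact (1 ≤ q)] (hpq : p.HolderConjugate q) (hp : p ≤ 2)
    (hq : 2 ≤ q) : lpSumDist n X p = lpSumDist n X q := by
  have hp' : p ≠ ∞ := ne_top_of_le_ne_top (by simp) hp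
  by_cases hq' : q = ∞
  · have := hpq.symm
    obtain rfl := (ENNReal.HolderConjugate.eq_top_iff_eq_one q p).1 hq'
    subst hq'
    rw [lpSumDist_one_eq hX hd, lpSumDist_top_eq hX hd]
  · have hr : p.toReal.HolderConjugate q.toReal :=
      ENNReal.HolderConjugate.toReal_of_ne_top hp' hq'
    refine le_antisymm ?_ ?_
    · exact lpSumDist_le_of_le_two hX hd hp (lpSumDist_nonneg q)
        (diagBound_two_left_of_two_right hp' hq' hr (lpSumDist_nonneg q)
          (diagBound_two_right_lpSumDist hX hd))
    · exact lpSumDist_le_of_two_le hX hd hq (lpSumDist_nonneg p)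
        (diagBound_two_right_of_two_left hp' hq' hr (diagBound_two_left_lpSumDist hX hd))

theorem isGreatest_range_lpSumDist_two (hk : 1 ≤ k) (hX : ∀ i, Module.finrank ℝ (X i) = n i)
    (hd : ∀ i, d i = banachMazurDist (X i) (EuclideanSpace ℝ (Fin (n i)))) :
    IsGreatest (Set.range d) (lpSumDist n X 2) := by
  have hd1 := one_le_of_eq_banachMazurDist hX hd
  have hge : ∀ i, d i ≤ lpSumDist n X 2 := fun i =>
    (le_abs_self _).trans ((diagBound_two_left_lpSumDist hX hd (p := 2)).abs_le i)
  have : Nonempty (Fin k) := ⟨⟨0, hk⟩⟩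
  obtain ⟨j, hj⟩ := Finite.exists_max d
  have hj0 : 0 ≤ d j := by linarith [hd1 j]
  refine ⟨⟨j, le_antisymm (hge j) ?_⟩, by rintro _ ⟨i, rfl⟩; exact hge i⟩
  -- On `ℓ_2` the norm of `diag(d)` is its largest entry, here `d j`.
  refine lpSumDist_le_of_le_two hX hd le_rfl hj0 fun t => ?_
  rw [← abs_of_nonneg hj0, ← lpNorm_smul]
  refine lpNorm_mono 2 fun i => ?_
  rw [Pi.smul_apply, smul_eq_mul, abs_mul, abs_mul, abs_of_nonneg hj0,
    abs_of_pos (by linarith [hd1 i])]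
  exact mul_le_mul_of_nonneg_right (hj i) (abs_nonneg _)

end LpSum

/-! ### Conjugate exponents on either side of `2`, and the theorem -/

theorem ENNReal.HolderConjugate.left_le_two_of_le {p q : ℝ≥0∞} (hpq : p.HolderConjugate q)
    (h : p ≤ q) : p ≤ 2 := by
  by_contra! hp
  have h1 : p⁻¹ < 2⁻¹ := ENNReal.inv_lt_inv.2 hp
  have h2 : q⁻¹ < 2⁻¹ := ENNReal.inv_lt_inv.2 (hp.trans_le h)
  have h3 := ENNReal.add_lt_add h1 h2
  rw [ENNReal.holderConjugate_iff.1 hpq, ENNReal.inv_two_add_inv_two] at h3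
  exact lt_irrefl _ h3

theorem ENNReal.HolderConjugate.two_le_right_of_le {p q : ℝ≥0∞} (hpq : p.HolderConjugate q)
    (h : p ≤ q) : 2 ≤ q := by
  by_contra! hq
  have h1 : 2⁻¹ < p⁻¹ := ENNReal.inv_lt_inv.2 (h.trans_lt hq)
  have h2 : 2⁻¹ < q⁻¹ := ENNReal.inv_lt_inv.2 hq
  have h3 := ENNReal.add_lt_add h1 h2
  rw [ENNReal.holderConjugate_iff.1 hpq, ENNReal.inv_two_add_inv_two] at h3
  exact lt_irrefl _ h3

theorem mainTheorem11 {k : ℕ} (hk : 1 ≤ k) (n : Fin k → ℕ) (hn : ∀ i, 1 ≤ n i)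
    (X : Fin k → Type*) [∀ i, NormedAddCommGroup (X i)] [∀ i, NormedSpace ℝ (X i)]
    [∀ i, FiniteDimensional ℝ (X i)] (hX : ∀ i, Module.finrank ℝ (X i) = n i)
    (d : Fin k → ℝ) (hd : ∀ i, d i = banachMazurDist (X i) (EuclideanSpace ℝ (Fin (n i)))) :
    IsGreatest (Set.range d) (lpSumDist n X 2) ∧
    (∀ (p : ℝ≥0∞) [Fact (1 ≤ p)], lpSumDist n X 2 ≤ lpSumDist n X p) ∧
    (∀ (p q : ℝ≥0∞) [Fact (1 ≤ p)] [Fact (1 ≤ q)], p.HolderConjugate q →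
      lpSumDist n X p = lpSumDist n X q) ∧
    (∀ (p : ℝ≥0∞) [Fact (1 ≤ p)], lpSumDist n X p ≤ lpSumDist n X 1) ∧
    lpSumDist n X 1 = lpSumDist n X ∞ ∧
    lpSumDist n X ∞ = Real.sqrt (∑ i, d i ^ 2) := by
  have : ∀ i, Nontrivial (X i) := fun i =>
    Module.nontrivial_of_finrank_pos (R := ℝ) (by rw [hX]; exact hn i)
  have hmax := isGreatest_range_lpSumDist_two hk hX hd
  refine ⟨hmax, fun p _ => ?_, fun p q _ _ hpq => ?_, fun p _ => lpSumDist_le_one hX hd p, ?_, ?_⟩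
  -- `f(2)` is some entry `d j`, and every entry is at most any bound for `diag(d)` from `ℓ_2` to
  -- `ℓ_p`, in particular `f(p)`.
  · obtain ⟨j, hj⟩ := hmax.1
    rw [← hj]
    exact (le_abs_self _).trans ((diagBound_two_left_lpSumDist hX hd).abs_le j)
  · rcases le_total p q with h | h
    · exact lpSumDist_eq_of_le_two hX hd hpq (hpq.left_le_two_of_le h) (hpq.two_le_right_of_le h)
    · have hqp : q.HolderConjugate p := hpq.symm
      exact (lpSumDist_eq_of_le_two hX hd hqp (hqp.left_le_two_of_le h)
        (hqp.two_le_right_of_le h)).symm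
  · rw [lpSumDist_one_eq hX hd, lpSumDist_top_eq hX hd]
  · rw [lpSumDist_top_eq hX hd, ← lpNorm_two_sq, Real.sqrt_sq (lpNorm_nonneg _ _)]
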